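/- Let $\mathcal A=\{A_1,\dots,A_k\}$ be a finite set of (non-empty) affine subspaces of $\mathbb R^n$ such that $A_i\subseteq A_j$ implies $A_i=A_j$. Let $\mathcal L=\mathcal L(\mathcal A)$ be the set of all non-empty intersections of one or more of the $A_i$, ordered by reverse inclusion, and write $B(x)\subseteq\mathbb R^n$ for the affine subspace corresponding to $x\in\mathcal L$; the minimal elements of $\mathcal L$ are $a_1,\dots,a_k$ with $B(a_i)=A_i$. Let $\mathcal N(\mathcal L)$ be the nerve complex, i.e. the simplicial complex whose simplices are the sets of minimal elements of $\mathcal L$ that have a join in $\mathcal L$, and let $\mathcal F(\mathcal N(\mathcal L))$ be the poset of its non-empty faces, ordered by inclusion. A diagram $\mathcal D$ of spaces over a poset $P$ assigns functorially a continuous map $\mathcal D(x)\to\mathcal D(y)$ to each relation $x\ge y$ in $P$. Its homotopy colimit $\mathbf{hocolim}(\mathcal D)$ is the colimit, over the non-empty finite chains of $P$, of the spaces $\Delta(P_{\le x_t})\times\mathcal D(x_1)$ attached to the chains $x_1>\dots>x_t$ (with $\Delta$ denoting the order complex), where passing to a subchain $x_{i_1}>\dots>x_{i_p}$ induces the product of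 the inclusion $\Delta(P_{\le x_t})\hookrightarrow\Delta(P_{\le x_{i_p}})$ and the map $\mathcal D(x_1)\to\mathcal D(x_{i_1})$. Consider - the Ziegler–Živaljević diagram $\mathcal{ZZ}$ over $\mathcal L$, given by $\mathcal{ZZ}(x)=B(x)$, with inclusions as maps; - the Vassiliev diagram $\mathcal V$ over $\mathcal F(\mathcal N(\mathcal L))$, given by $\mathcal V(\{a_{i_1},\dots,a_{i_q}\})=A_{i_1}\cap\dots\cap A_{i_q}$, with inclusions as maps. Sending $x\in\mathcal L$ to the face $\{a\in\min\mathcal L\mid a\le x\}$ is a monotone map $\mathcal L\to\mathcal F(\mathcal N(\mathcal L))$ which, with the inclusions of $B(x)$ in the values of $\mathcal V$ at these faces, induces a continuous map $\mathbf{hocolim}(\mathcal{ZZ})\to\mathbf{hocolim}(\mathcal V)$. Extend it to the one-point compactifications by $\infty\mapsto\infty$. **Theorem.** The map $\mathbf{hocolim}(\mathcal{ZZ})\cup\{\infty\}\to\mathbf{hocolim}(\mathcal V)\cup\{\infty\}$ is a topological embedding, and its image is a deformation retract of $\mathbf{hocolim}(\mathcal V)\cup\{\infty\}$: the identity of $\mathbf{hocolim}(\mathcal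 V)\cup\{\infty\}$ is homotopic, by a homotopy that is stationary on the image, to a map whose values lie in the image. -/

import Mathlib

namespace SubspaceModels

open CategoryTheory Opposite PartialOrder

/-! ### Chains and order complexes -/

section Chains

universe u

variable {P : Type u} [PartialOrder P]

theorem exists_isGreatest_chain (c : NonemptyFiniteChains P) :
    ∃ x, IsGreatest (c.finset : Set P) x := by
  obtain ⟨x, hx, hmax⟩ := c.finset.exists_maximal c.nonempty
  refine ⟨x, hx, fun y hy => ?_⟩
  rcases c.comparable ⟨x, hx⟩ ⟨y, hy⟩ with h | h
  · exact hmax hy h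
  · exact h

theorem exists_isLeast_chain (c : NonemptyFiniteChains P) :
    ∃ x, IsLeast (c.finset : Set P) x := by
  obtain ⟨x, hx, hmin⟩ := c.finset.exists_minimal c.nonempty
  refine ⟨x, hx, fun y hy => ?_⟩
  rcases c.comparable ⟨x, hx⟩ ⟨y, hy⟩ with h | h
  · exact h
  · exact hmin hy h

/-- The largest element `x₁` of a nonempty finite chain `x₁ > ⋯ > x_t`. -/
noncomputable def chainMax (c : NonemptyFiniteChains P) : P :=
  (exists_isGreatest_chain c).choose

/-- The smallest element `x_t` of a nonempty finite chain `x₁ > ⋯ > x_t`. -/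
noncomputable def chainMin (c : NonemptyFiniteChains P) : P :=
  (exists_isLeast_chain c).choose

theorem chainMax_spec (c : NonemptyFiniteChains P) :
    IsGreatest (c.finset : Set P) (chainMax c) :=
  (exists_isGreatest_chain c).choose_spec

theorem chainMin_spec (c : NonemptyFiniteChains P) :
    IsLeast (c.finset : Set P) (chainMin c) :=
  (exists_isLeast_chain c).choose_spec

theorem chainMax_mono {c c' : NonemptyFiniteChains P} (h : c' ≤ c) :
    chainMax c' ≤ chainMax c :=
  (chainMax_spec c).2 (h (chainMax_spec c').1)

theorem chainMin_anti {c c' : NonemptyFiniteChains P} (h : c' ≤ c) :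
    chainMin c ≤ chainMin c' :=
  (chainMin_spec c).2 (h (chainMin_spec c').1)

/-- The order complex `Δ(Q)` of a subset `Q` of a finite poset `P`, i.e. the geometric
realization of the simplicial complex whose simplices are the nonempty chains of `Q`. A point is
given by its barycentric coordinates, which are extended by zero outside `Q`; as `P` is finite,
the topology of the realization is the one induced from `P → ℝ`. -/
def orderComplex [Fintype P] (Q : Set P) : Set (P → ℝ) :=
  {w | w ∈ stdSimplex ℝ P ∧ Function.support w ⊆ Q ∧ IsChain (· ≤ ·) (Function.support w)}

theorem orderComplex_mono [Fintype P] {Q R : Set P} (h : Q ⊆ R) :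
    orderComplex Q ⊆ orderComplex R :=
  fun _ hw => ⟨hw.1, hw.2.1.trans h, hw.2.2⟩

end Chains

/-! ### Homotopy colimits

A diagram of spaces over a poset `P` is a functor `Pᵒᵖ ⥤ TopCat`: there is one morphism `x → y`
for every order relation `x ≥ y`. -/

section Hocolim

universe u

variable {P : Type u} [PartialOrder P]

/-- The diagram `Δ(D)` over the barycentric subdivision of `P` (the poset of nonempty chains of
`P`, ordered by inclusion), given by `(x₁ > ⋯ > x_t) ↦ Δ(P_{≤ x_t}) × D(x₁)`; to the passage to a
subchain `x_{i₁} > ⋯ > x_{i_p}` it assigns the product of the inclusion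
`Δ(P_{≤ x_t}) ⊆ Δ(P_{≤ x_{i_p}})` and the map `D(x₁ → x_{i₁})`. -/
noncomputable def chainDiagram [Fintype P] (D : Pᵒᵖ ⥤ TopCat.{u}) :
    (NonemptyFiniteChains P)ᵒᵖ ⥤ TopCat.{u} where
  obj c := TopCat.of
    (orderComplex (Set.Iic (chainMin c.unop)) × D.obj (op (chainMax c.unop)))
  map {c c'} f := TopCat.ofHom
    ⟨Prod.map
      (Set.inclusion (orderComplex_mono (Set.Iic_subset_Iic.2 (chainMin_anti (leOfHom f.unop)))))
      (D.map (homOfLE (chainMax_mono (leOfHom f.unop))).op),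
     (continuous_inclusion _).prodMap (D.map _).hom.continuous⟩
  map_id c := by
    refine TopCat.hom_ext (ContinuousMap.ext ?_)
    rintro ⟨w, d⟩
    refine Prod.ext rfl ?_
    change D.map (𝟙 _) d = d
    simp
  map_comp {c c' c''} f g := by
    refine TopCat.hom_ext (ContinuousMap.ext ?_)
    rintro ⟨w, d⟩
    refine Prod.ext rfl ?_
    change D.map _ d = D.map _ (D.map _ d)
    rw [← TopCat.comp_app, ← D.map_comp]
    rfl

/-- The homotopy colimit of a diagram of spaces over a finite poset. -/
noncomputable def hocolim [Fintype P] (D : Pᵒᵖ ⥤ TopCat.{u}) : TopCat.{u} :=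
  Limits.colimit (chainDiagram D)

variable {Q : Type u} [PartialOrder Q]

theorem chainMin_map_le (f : P →o Q) (c : NonemptyFiniteChains P) :
    f (chainMin c) ≤ chainMin (c.map f) := by
  obtain ⟨x, hx, hfx⟩ :=
    (NonemptyFiniteChains.mem_map_iff c f _).1 (chainMin_spec (c.map f)).1
  exact hfx ▸ f.monotone ((chainMin_spec c).2 hx)

theorem chainMax_map_le (f : P →o Q) (c : NonemptyFiniteChains P) :
    chainMax (c.map f) ≤ f (chainMax c) := by
  obtain ⟨x, hx, hfx⟩ :=
    (NonemptyFiniteChains.mem_map_iff c f _).1 (chainMax_spec (c.map f)).1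
  exact hfx ▸ f.monotone ((chainMax_spec c).2 hx)

variable [Fintype P] [Fintype Q]

/-- The map `Δ(R) → Δ(S)` given by a monotone map of posets that carries `R` to `S`: it is affine
on each simplex and has the given effect on vertices. -/
noncomputable def orderComplexMap (f : P →o Q) {R : Set P} {S : Set Q} (h : Set.MapsTo f R S) :
    C(orderComplex R, orderComplex S) where
  toFun w := ⟨stdSimplex.map f ⟨w.1, w.2.1⟩, by
    classical
    have hs : Function.support (stdSimplex.map f ⟨w.1, w.2.1⟩ : Q → ℝ) ⊆
        f '' Function.support w.1 := by
      intro q hq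
      rw [Function.mem_support, stdSimplex.map_coe, FunOnFinite.linearMap_apply_apply] at hq
      obtain ⟨p, hp, hp0⟩ := Finset.exists_ne_zero_of_sum_ne_zero hq
      exact ⟨p, hp0, by simpa using hp⟩
    refine ⟨Subtype.property _, hs.trans ?_, ?_⟩
    · rintro _ ⟨p, hp, rfl⟩
      exact h (w.2.2.1 hp)
    · refine IsChain.mono hs ?_
      rintro _ ⟨p, hp, rfl⟩ _ ⟨q, hq, rfl⟩ -
      exact (w.2.2.2.total hp hq).imp (fun h => f.monotone h) (fun h => f.monotone h)⟩
  continuous_toFun := by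
    refine Continuous.subtype_mk ?_ _
    exact continuous_subtype_val.comp ((stdSimplex.continuous_map f).comp (by fun_prop))

/-- The natural transformation between the diagrams `Δ(D)` and `Δ(E)` that is induced by a
monotone map `f` of the index posets and a natural family of maps `α_x : D(x) → E(f x)`:
on the chain `x₁ > ⋯ > x_t` it is the product of `Δ(P_{≤ x_t}) → Δ(Q_{≤ f x_t})` and `α_{x₁}`. -/
noncomputable def chainDiagramMap (f : P →o Q) {D : Pᵒᵖ ⥤ TopCat.{u}} {E : Qᵒᵖ ⥤ TopCat.{u}}
    (α : D ⟶ f.monotone.functor.op ⋙ E) :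
    chainDiagram D ⟶
      (NonemptyFiniteChains.orderHomMap f).monotone.functor.op ⋙ chainDiagram E where
  app c := TopCat.ofHom
    ⟨Prod.map
      (orderComplexMap f (R := Set.Iic (chainMin c.unop))
        (S := Set.Iic (chainMin (c.unop.map f)))
        fun _ hx => (f.monotone hx).trans (chainMin_map_le f c.unop))
      (α.app (op (chainMax c.unop)) ≫ E.map (homOfLE (chainMax_map_le f c.unop)).op),
     (ContinuousMap.continuous _).prodMap (TopCat.Hom.hom _).continuous⟩
  naturality {c c'} g := by
    refine TopCat.hom_ext (ContinuousMap.ext ?_)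
    rintro ⟨w, d⟩
    refine Prod.ext (Subtype.ext rfl) ?_
    have key : D.map (homOfLE (chainMax_mono (leOfHom g.unop))).op ≫
        α.app (op (chainMax c'.unop)) ≫ E.map (homOfLE (chainMax_map_le f c'.unop)).op =
        (α.app (op (chainMax c.unop)) ≫ E.map (homOfLE (chainMax_map_le f c.unop)).op) ≫
        E.map (homOfLE (chainMax_mono
          ((NonemptyFiniteChains.orderHomMap f).monotone (leOfHom g.unop)))).op := by
      rw [α.naturality_assoc, Category.assoc, Functor.comp_map]
      exact congrArg (α.app (op (chainMax c.unop)) ≫ ·)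
        (((E.map_comp _ _).symm.trans (congrArg E.map (Subsingleton.elim _ _))).trans
          (E.map_comp _ _))
    exact ConcreteCategory.congr_hom key d

/-- The map of homotopy colimits induced by a monotone map of the index posets and a natural
family of maps `D(x) → E(f x)`. -/
noncomputable def hocolimMap (f : P →o Q) {D : Pᵒᵖ ⥤ TopCat.{u}} {E : Qᵒᵖ ⥤ TopCat.{u}}
    (α : D ⟶ f.monotone.functor.op ⋙ E) : hocolim D ⟶ hocolim E :=
  Limits.colimMap (chainDiagramMap f α) ≫ Limits.colimit.pre (chainDiagram E) _

end Hocolim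

/-! ### Semilattices and their nerve complexes -/

section Nerve

universe u

/-- Two elements with a common upper bound have a join, and two elements with a common lower
bound have a meet. -/
structure IsSemilattice (P : Type u) [PartialOrder P] : Prop where
  join : ∀ x y : P, (∃ z, x ≤ z ∧ y ≤ z) → ∃ z, IsLUB {x, y} z
  meet : ∀ x y : P, (∃ z, z ≤ x ∧ z ≤ y) → ∃ z, IsGLB {x, y} z

variable {P : Type u} [PartialOrder P]

theorem IsSemilattice.exists_isLUB (hP : IsSemilattice P) (s : Finset P) (hs : s.Nonempty)
    (hb : BddAbove (s : Set P)) : ∃ x, IsLUB (s : Set P) x := by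
  classical
  induction hs using Finset.Nonempty.cons_induction with
  | singleton a => exact ⟨a, by simp⟩
  | cons a s ha hs ih =>
    obtain ⟨b, hb⟩ := hb
    have hba : a ≤ b := hb (by simp)
    have hbs : b ∈ upperBounds (s : Set P) := fun x hx => hb (by simp_all)
    obtain ⟨x, hx⟩ := ih ⟨b, hbs⟩
    obtain ⟨y, hy⟩ := hP.join a x ⟨b, hba, hx.2 hbs⟩
    refine ⟨y, ?_, fun z hz => ?_⟩
    · intro z hz
      rcases Finset.mem_cons.1 (Finset.mem_coe.1 hz) with rfl | hz
      · exact hy.1 (by simp)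
      · exact (hx.1 hz).trans (hy.1 (by simp))
    · refine hy.2 ?_
      rintro w (rfl | rfl)
      · exact hz (by simp)
      · exact hx.2 fun v hv => hz (by simp_all)

/-- The nerve complex `N(P)` of a semilattice `P`: its simplices are the nonempty finite sets of
minimal elements of `P` that have a join in `P`. -/
def nerveComplex (hP : IsSemilattice P) : PreAbstractSimplicialComplex P where
  faces := {s | s.Nonempty ∧ (∀ a ∈ s, IsMin a) ∧ ∃ x, IsLUB (s : Set P) x}
  isRelLowerSet_faces := by
    rintro s ⟨hs, hmin, x, hx⟩
    refine ⟨hs, fun t hts ht => ⟨ht, fun a ha => hmin a (hts ha), ?_⟩⟩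
    exact hP.exists_isLUB t ht ⟨x, fun a ha => hx.1 (hts ha)⟩

/-- The face poset of a simplicial complex: its nonempty faces, ordered by inclusion. -/
abbrev FacePoset {V : Type u} (K : PreAbstractSimplicialComplex V) : Type u :=
  {s : Finset V // s ∈ K.faces}

noncomputable instance {V : Type u} [Fintype V] (K : PreAbstractSimplicialComplex V) :
    Fintype (FacePoset K) :=
  Fintype.ofFinite _

open scoped Classical in
/-- The complete set of minimal elements attached to `x`, namely `{a ∈ min P | a ≤ x}`,
as a face of the nerve complex. -/
noncomputable def completeFace [Fintype P] (hP : IsSemilattice P) :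
    P →o FacePoset (nerveComplex hP) where
  toFun x := ⟨Finset.univ.filter fun a => IsMin a ∧ a ≤ x, by
    have hne : (Finset.univ.filter fun a : P => IsMin a ∧ a ≤ x).Nonempty := by
      obtain ⟨a, hax, ha⟩ := Finite.exists_le_minimal (p := fun _ : P => True) (a := x) trivial
      exact ⟨a, by simpa using ⟨fun b hb => ha.2 trivial hb, hax⟩⟩
    exact ⟨hne, fun a ha => (Finset.mem_filter.1 ha).2.1,
      hP.exists_isLUB _ hne ⟨x, fun a ha => (Finset.mem_filter.1 ha).2.2⟩⟩⟩
  monotone' x y hxy a ha := by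
    simp only [Finset.mem_filter, Finset.mem_univ, true_and] at ha ⊢
    exact ⟨ha.1, ha.2.trans hxy⟩

end Nerve

/-! ### Subspace arrangements and their two models -/

section Arrangements

/-- A (finite, affine) subspace arrangement in `ℝⁿ`. -/
structure SubspaceArrangement (n : ℕ) where
  subspaces : Finset (AffineSubspace ℝ (EuclideanSpace ℝ (Fin n)))
  nonempty : ∀ B ∈ subspaces, (B : Set (EuclideanSpace ℝ (Fin n))).Nonempty
  eq_of_le : ∀ B ∈ subspaces, ∀ C ∈ subspaces, B ≤ C → B = C

variable {n : ℕ} (A : SubspaceArrangement n)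

/-- The intersection semilattice: all nonempty intersections of (one or more) members of the
arrangement, ordered by reverse inclusion. -/
def IntersectionSemilattice : Type :=
  {B : (AffineSubspace ℝ (EuclideanSpace ℝ (Fin n)))ᵒᵈ //
    (∃ S : Finset (AffineSubspace ℝ (EuclideanSpace ℝ (Fin n))),
      S.Nonempty ∧ S ⊆ A.subspaces ∧ OrderDual.ofDual B = sInf (S : Set _)) ∧
    ((OrderDual.ofDual B : AffineSubspace ℝ (EuclideanSpace ℝ (Fin n))) :
      Set (EuclideanSpace ℝ (Fin n))).Nonempty}

instance : PartialOrder (IntersectionSemilattice A) :=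
  inferInstanceAs (PartialOrder (Subtype _))

variable {A} in
/-- The affine subspace `B(x)` that the element `x` of the intersection semilattice is. -/
def IntersectionSemilattice.subspace (x : IntersectionSemilattice A) :
    AffineSubspace ℝ (EuclideanSpace ℝ (Fin n)) :=
  OrderDual.ofDual x.1

variable {A} in
theorem IntersectionSemilattice.le_iff (x y : IntersectionSemilattice A) :
    x ≤ y ↔ y.subspace ≤ x.subspace :=
  Iff.rfl

instance : Finite (IntersectionSemilattice A) := by
  classical
  let g : IntersectionSemilattice A → A.subspaces.powerset := fun x =>
    ⟨x.2.1.choose, Finset.mem_powerset.2 x.2.1.choose_spec.2.1⟩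
  refine Finite.of_injective g fun x y hxy => Subtype.ext ?_
  have h : x.2.1.choose = y.2.1.choose := congrArg Subtype.val hxy
  have hx := x.2.1.choose_spec.2.2
  rw [h] at hx
  exact OrderDual.ofDual.injective (hx.trans y.2.1.choose_spec.2.2.symm)

noncomputable instance : Fintype (IntersectionSemilattice A) :=
  Fintype.ofFinite _

theorem isSemilattice_intersectionSemilattice : IsSemilattice (IntersectionSemilattice A) where
  join := by
    classical
    rintro ⟨x, ⟨S, hS, hSA, hxS⟩, hx⟩ ⟨y, ⟨T, hT, hTA, hyT⟩, hy⟩ ⟨z, hzx, hzy⟩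
    refine ⟨⟨OrderDual.toDual (OrderDual.ofDual x ⊓ OrderDual.ofDual y),
      ⟨S ∪ T, hS.mono Finset.subset_union_left, Finset.union_subset hSA hTA, ?_⟩, ?_⟩, ?_, ?_⟩
    · rw [Finset.coe_union, sInf_union, ← hxS, ← hyT]
      rfl
    · obtain ⟨p, hp⟩ := z.2.2
      exact ⟨p, AffineSubspace.mem_inf_iff _ _ _ |>.2 ⟨hzx hp, hzy hp⟩⟩
    · rintro w (rfl | rfl)
      · exact (inf_le_left : OrderDual.ofDual x ⊓ OrderDual.ofDual y ≤ OrderDual.ofDual x)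
      · exact (inf_le_right : OrderDual.ofDual x ⊓ OrderDual.ofDual y ≤ OrderDual.ofDual y)
    · intro w hw
      exact le_inf ((IntersectionSemilattice.le_iff _ _).1 (hw (Set.mem_insert _ _)))
        ((IntersectionSemilattice.le_iff _ _).1 (hw (Set.mem_insert_of_mem _ rfl)))
  meet := by
    classical
    rintro x y ⟨z, hzx, hzy⟩
    obtain ⟨⟨S, hS, hSA, hzS⟩, hz⟩ := z.2
    let T := A.subspaces.filter fun C => x.subspace ≤ C ∧ y.subspace ≤ C
    have hxT : x.subspace ≤ sInf (T : Set _) :=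
      le_sInf fun C hC => (Finset.mem_filter.1 hC).2.1
    have hyT : y.subspace ≤ sInf (T : Set _) :=
      le_sInf fun C hC => (Finset.mem_filter.1 hC).2.2
    have key : ∀ U : Finset (AffineSubspace ℝ (EuclideanSpace ℝ (Fin n))), U ⊆ A.subspaces →
        x.subspace ≤ sInf (U : Set _) → y.subspace ≤ sInf (U : Set _) → U ⊆ T := by
      intro U hU h1 h2 C hC
      exact Finset.mem_filter.2 ⟨hU hC, h1.trans (sInf_le hC), h2.trans (sInf_le hC)⟩
    refine ⟨⟨OrderDual.toDual (sInf (T : Set _)), ⟨T, ?_, Finset.filter_subset _ _, rfl⟩, ?_⟩,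
      ?_, ?_⟩
    · exact hS.mono (key S hSA (hzS ▸ hzx) (hzS ▸ hzy))
    · obtain ⟨p, hp⟩ := x.2.2
      exact ⟨p, hxT hp⟩
    · rintro w (rfl | rfl)
      · exact hxT
      · exact hyT
    · intro w hw
      obtain ⟨⟨U, hU, hUA, hwU⟩, -⟩ := w.2
      have h1 := (IntersectionSemilattice.le_iff _ _).1 (hw (Set.mem_insert _ _))
      have h2 := (IntersectionSemilattice.le_iff _ _).1 (hw (Set.mem_insert_of_mem _ rfl))
      refine (IntersectionSemilattice.le_iff _ _).2 ?_
      change sInf (T : Set _) ≤ OrderDual.ofDual w.1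
      rw [hwU]
      exact sInf_le_sInf (Finset.coe_subset.2 (key U hUA (hwU ▸ h1) (hwU ▸ h2)))

/-- The Ziegler–Živaljević diagram over the intersection semilattice: `x ↦ B(x)`, with
inclusions as maps. -/
def zzDiagram : (IntersectionSemilattice A)ᵒᵖ ⥤ TopCat.{0} where
  obj x := TopCat.of x.unop.subspace
  map {x y} f := TopCat.ofHom
    ⟨Set.inclusion ((IntersectionSemilattice.le_iff _ _).1 (leOfHom f.unop)),
      continuous_inclusion _⟩

/-- The face poset of the nerve complex of the intersection semilattice. -/
abbrev NerveFaces : Type :=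
  FacePoset (nerveComplex (isSemilattice_intersectionSemilattice A))

variable {A} in
/-- The intersection of the subspaces that are the vertices of a face of the nerve complex. -/
def faceIntersection (s : NerveFaces A) : Set (EuclideanSpace ℝ (Fin n)) :=
  ⋂ a ∈ s.1, (a.subspace : Set (EuclideanSpace ℝ (Fin n)))

variable {A} in
theorem faceIntersection_anti {s t : NerveFaces A} (h : s ≤ t) :
    faceIntersection t ⊆ faceIntersection s :=
  Set.biInter_subset_biInter_left h

/-- The Vassiliev diagram over the nerve complex of the intersection semilattice:
`{a₁, …, a_k} ↦ A₁ ∩ ⋯ ∩ A_k`, with inclusions as maps. -/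
def vassilievDiagram : (NerveFaces A)ᵒᵖ ⥤ TopCat.{0} where
  obj s := TopCat.of (faceIntersection s.unop)
  map {s t} f := TopCat.ofHom
    ⟨Set.inclusion (faceIntersection_anti (leOfHom f.unop)), continuous_inclusion _⟩

variable {A} in
theorem subspace_subset_faceIntersection (x : IntersectionSemilattice A) :
    (x.subspace : Set (EuclideanSpace ℝ (Fin n))) ⊆
      faceIntersection (completeFace (isSemilattice_intersectionSemilattice A) x) := by
  classical
  refine Set.subset_iInter₂ fun a ha => ?_
  exact (IntersectionSemilattice.le_iff _ _).1 (Finset.mem_filter.1 ha).2.2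

/-- The natural family of inclusions of `B(x)` in the value of the Vassiliev diagram at the
complete face of `x`. -/
noncomputable def zzToVassiliev :
    zzDiagram A ⟶
      (completeFace (isSemilattice_intersectionSemilattice A)).monotone.functor.op ⋙
        vassilievDiagram A where
  app x := TopCat.ofHom
    ⟨Set.inclusion (subspace_subset_faceIntersection x.unop), continuous_inclusion _⟩

/-- The canonical map from the homotopy colimit of the Ziegler–Živaljević diagram to the homotopy
colimit of the Vassiliev diagram. -/
noncomputable def comparisonMap :
    C(hocolim (zzDiagram A), hocolim (vassilievDiagram A)) :=
  (hocolimMap _ (zzToVassiliev A)).hom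

end Arrangements

/-- `S` is a (strong) deformation retract of `X`: the identity of `X` is homotopic, relative to
`S`, to a map with values in `S`. -/
def IsDeformationRetract {X : Type*} [TopologicalSpace X] (S : Set X) : Prop :=
  ∃ r : C(X, X), (∀ x, r x ∈ S) ∧ (ContinuousMap.id X).HomotopicRel r S

end SubspaceModels

/-!
The homotopy colimit of a diagram of closed subspaces `V x` of `E` over a finite poset `P`, with
inclusions as maps, embeds as a closed subset of `ℝ^P × E` (`isClosedEmbedding_hocolimToProd`).
Its image consists of the pairs `(w, e)` of a point `w` of the order complex of `P` and a point `e`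
that lies in `V x` for each vertex `x` of the simplex carrying `w` (`range_hocolimToProd`). In these
coordinates the comparison map sends `(w, e)` to `(u_* w, e)`, where `u_*` is the push-forward along
the map `u = completeFace` (`hocolimToProd_hocolimMap`).

Every `x` in the intersection semilattice is the join of the minimal elements below it, so `u` is
injective with left adjoint `l = faceJoin`. Hence the comparison map is a closed embedding of
locally compact Hausdorff spaces, which gives an embedding of one-point compactifications.
Moreover `c = u ∘ l` is a closure operator on the faces of the nerve, and the Vassiliev diagram has
the same value at `s` and at `c s`. So `(w, e) ↦ (c_* w, e)` is a map of the homotopy colimit to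
itself, with values in the image of the comparison map. To deform the identity to it, apply `c` to
one rank of faces after another, starting with the largest faces: two consecutive maps `f ≤ g` in
this sequence satisfy `g x ≤ f y` for `x < y`, so that `f(C) ∪ g(C)` is a chain for each chain `C`,
and the straight-line homotopy from `f_* w` to `g_* w` stays in the realization
(`lineMap_mem_realization`). These homotopies fix the points carried by closed faces. They also
preserve the coordinate in `E` while the other one stays in a compact simplex, so they are proper
and extend to the one-point compactifications (`continuous_onePointMap_homotopy`).
-/

namespace SubspaceModels

open PartialOrder Topology unitInterval Function

/-! ### Push-forward of barycentric coordinates -/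

section Pushforward

variable {P Q : Type*} [Fintype P] [Fintype Q]

theorem support_linearMap_subset (f : P → Q) (w : P → ℝ) :
    support (FunOnFinite.linearMap ℝ ℝ f w) ⊆ f '' support w := by
  classical
  intro q hq
  rw [mem_support, FunOnFinite.linearMap_apply_apply] at hq
  obtain ⟨p, hp, hp0⟩ := Finset.exists_ne_zero_of_sum_ne_zero hq
  exact ⟨p, hp0, by simpa using hp⟩

theorem linearMap_mem_stdSimplex (f : P → Q) {w : P → ℝ} (hw : w ∈ stdSimplex ℝ P) :
    FunOnFinite.linearMap ℝ ℝ f w ∈ stdSimplex ℝ Q :=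
  (stdSimplex.map f ⟨w, hw⟩).2

theorem injective_linearMap {f : P → Q} (hf : Injective f) :
    Injective (FunOnFinite.linearMap ℝ ℝ f) := by
  classical
  intro v w h
  funext p
  have := congrFun h (f p)
  have hp : Finset.univ.filter (fun x => f x = f p) = {p} := by
    ext x; simp [hf.eq_iff]
  simpa [FunOnFinite.linearMap_apply_apply, hp] using this

theorem linearMap_eq_self {f : P → P} {w : P → ℝ} (h : ∀ x ∈ support w, f x = x) :
    FunOnFinite.linearMap ℝ ℝ f w = w := by
  classical
  funext p
  rw [FunOnFinite.linearMap_apply_apply]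
  have h1 : ∀ x ∈ Finset.univ.filter (fun x => f x = p), x ≠ p → w x = 0 := by
    intro x hx hxp
    by_contra hw
    exact hxp ((h x hw).symm.trans (Finset.mem_filter.1 hx).2)
  refine Finset.sum_eq_single p h1 fun hp => ?_
  by_contra hw
  exact hp (by simpa using h p hw)

end Pushforward

/-! ### Realizations of subset-valued diagrams -/

section Realization

variable {P Q E : Type*} [PartialOrder P] [Fintype P] [PartialOrder Q] [Fintype Q]

/-- The concrete model, inside `ℝ^P × E`, of the homotopy colimit of the diagram of subsets `V` of
`E` and inclusions between them: the pairs of a point `w` of the order complex of `P` and a point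
of `E` that lies in `V x` for each vertex `x` of the simplex carrying `w`. For antitone `V` this is
the union of the sets `Δ(P_{≤ x}) × V x`. -/
def realization (V : P → Set E) : Set ((P → ℝ) × E) :=
  {z | z.1 ∈ stdSimplex ℝ P ∧ IsChain (· ≤ ·) (support z.1) ∧ ∀ x ∈ support z.1, z.2 ∈ V x}

theorem linearMap_mem_realization {f : P →o Q} {V : P → Set E} {W : Q → Set E}
    (h : ∀ x, V x ⊆ W (f x)) {z : (P → ℝ) × E} (hz : z ∈ realization V) :
    (FunOnFinite.linearMap ℝ ℝ f z.1, z.2) ∈ realization W := by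
  refine ⟨linearMap_mem_stdSimplex f hz.1, ?_, ?_⟩
  · refine IsChain.mono (support_linearMap_subset f z.1) ?_
    rintro _ ⟨p, hp, rfl⟩ _ ⟨q, hq, rfl⟩ -
    exact (hz.2.1.total hp hq).imp (fun h => f.monotone h) (fun h => f.monotone h)
  · intro y hy
    obtain ⟨x, hx, rfl⟩ := support_linearMap_subset f z.1 hy
    exact h x (hz.2.2 x hx)

/-- The push-forwards along two contiguous maps are joined by a segment in the realization: for a
chain `C`, the hypotheses make `f(C) ∪ g(C)` a chain. -/
theorem lineMap_mem_realization {f g : P →o P} {V : P → Set E} (hfg : f ≤ g)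
    (hlt : ∀ x y, x < y → g x ≤ f y) (hf : ∀ x, V x ⊆ V (f x)) (hg : ∀ x, V x ⊆ V (g x))
    {z : (P → ℝ) × E} (hz : z ∈ realization V) (t : I) :
    (AffineMap.lineMap (FunOnFinite.linearMap ℝ ℝ f z.1) (FunOnFinite.linearMap ℝ ℝ g z.1) (t : ℝ),
      z.2) ∈ realization V := by
  have hsupp : support (AffineMap.lineMap (FunOnFinite.linearMap ℝ ℝ f z.1)
      (FunOnFinite.linearMap ℝ ℝ g z.1) (t : ℝ)) ⊆ f '' support z.1 ∪ g '' support z.1 := by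
    intro p hp
    by_contra hn
    rw [Set.mem_union, not_or] at hn
    have h1 := notMem_support.1 fun h => hn.1 (support_linearMap_subset f z.1 h)
    have h2 := notMem_support.1 fun h => hn.2 (support_linearMap_subset g z.1 h)
    exact hp (by simp [AffineMap.lineMap_apply, h1, h2])
  have hcomp : ∀ x ∈ support z.1, ∀ y ∈ support z.1, f x ≤ g y ∨ g y ≤ f x := by
    intro x hx y hy
    rcases hz.2.1.total hx hy with h | h
    · exact .inl ((hfg x).trans (g.monotone h))
    · rcases h.eq_or_lt with rfl | h
      · exact .inl (hfg _)
      · exact .inr (hlt _ _ h)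
  refine ⟨?_, ?_, ?_⟩
  · exact (convex_stdSimplex ℝ P).lineMap_mem (linearMap_mem_stdSimplex f hz.1)
      (linearMap_mem_stdSimplex g hz.1) t.2
  · refine IsChain.mono hsupp ?_
    rintro _ (⟨x, hx, rfl⟩ | ⟨x, hx, rfl⟩) _ (⟨y, hy, rfl⟩ | ⟨y, hy, rfl⟩) -
    · exact (hz.2.1.total hx hy).imp (fun h => f.monotone h) (fun h => f.monotone h)
    · exact hcomp x hx y hy
    · exact (hcomp y hy x hx).symm
    · exact (hz.2.1.total hx hy).imp (fun h => g.monotone h) (fun h => g.monotone h)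
  · intro y hy
    rcases hsupp hy with ⟨x, hx, rfl⟩ | ⟨x, hx, rfl⟩
    · exact hf x (hz.2.2 x hx)
    · exact hg x (hz.2.2 x hx)

end Realization

/-! ### Maps and homotopies on one-point compactifications -/

section OnePoint

variable {X Y : Type*} [TopologicalSpace X] [TopologicalSpace Y]

theorem isEmbedding_onePointMap [T2Space Y] [LocallyCompactSpace Y] {f : X → Y}
    (hf : IsClosedEmbedding f) : IsEmbedding (OnePoint.map f) := by
  have := hf.isEmbedding.t2Space
  have hc : Continuous (OnePoint.map f) :=
    OnePoint.continuous_map hf.continuous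
      (by simpa only [Filter.coclosedCompact_eq_cocompact] using hf.tendsto_cocompact)
  exact (hc.isClosedEmbedding (Option.map_injective hf.injective)).isEmbedding

/-- A homotopy that is proper, uniformly in the parameter, extends to the one-point
compactification. -/
theorem continuous_onePointMap_homotopy {T : Type*} [TopologicalSpace T] {G : T × X → X}
    (hG : Continuous G)
    (hK : ∀ K : Set X, IsClosed K → IsCompact K →
      ∃ K' : Set X, IsClosed K' ∧ IsCompact K' ∧ ∀ t x, G (t, x) ∈ K → x ∈ K') :
    Continuous fun p : T × OnePoint X => OnePoint.map (fun x => G (p.1, x)) p.2 := by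
  rw [continuous_iff_continuousAt]
  rintro ⟨t, x⟩
  induction x using OnePoint.rec with
  | infty =>
    rw [ContinuousAt, OnePoint.map_infty, OnePoint.hasBasis_nhds_infty.tendsto_right_iff]
    rintro K ⟨hKc, hKk⟩
    obtain ⟨K', hc, hk, h⟩ := hK K hKc hKk
    have hmem := OnePoint.hasBasis_nhds_infty.mem_of_mem (i := K') ⟨hc, hk⟩
    rw [nhds_prod_eq]
    filter_upwards [Filter.prod_mem_prod Filter.univ_mem hmem]
    rintro ⟨s, y⟩ ⟨-, hy⟩
    rcases hy with ⟨y, hy, rfl⟩ | rfl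
    · exact .inl ⟨_, fun hn => hy (h s y hn), rfl⟩
    · exact .inr rfl
  | coe x =>
    have ho : IsOpenEmbedding (Prod.map id ((↑) : X → OnePoint X) : T × X → T × OnePoint X) :=
      IsOpenEmbedding.id.prodMap OnePoint.isOpenEmbedding_coe
    refine (ho.continuousAt_iff (x := (t, x))).1 ?_
    exact (OnePoint.continuous_coe.comp hG).continuousAt

end OnePoint

/-! ### The deformation -/

section Deformation

variable {P E T : Type*} [PartialOrder P] [Fintype P] [TopologicalSpace E] [TopologicalSpace T]
  {V : P → Set E} {j : T → (P → ℝ) × E}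

/-- The straight-line homotopy between two contiguous push-forwards, on a space `T` that is
identified with the realization by `j`. -/
theorem exists_pushforward_homotopy (hj : IsClosedEmbedding j) (hr : Set.range j = realization V)
    {f g : P →o P} (hfg : f ≤ g) (hlt : ∀ x y, x < y → g x ≤ f y)
    (hf : ∀ x, V x ⊆ V (f x)) (hg : ∀ x, V x ⊆ V (g x)) :
    ∃ G : I × T → T, Continuous G ∧ ∀ t x, j (G (t, x)) =
      (AffineMap.lineMap (FunOnFinite.linearMap ℝ ℝ f (j x).1)
        (FunOnFinite.linearMap ℝ ℝ g (j x).1) (t : ℝ), (j x).2) := by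
  have hmem : ∀ p : I × T, ∃ y, j y =
      (AffineMap.lineMap (FunOnFinite.linearMap ℝ ℝ f (j p.2).1)
        (FunOnFinite.linearMap ℝ ℝ g (j p.2).1) (p.1 : ℝ), (j p.2).2) := fun p =>
    hr.ge (lineMap_mem_realization hfg hlt hf hg (hr.le ⟨p.2, rfl⟩) p.1)
  choose G hG using hmem
  refine ⟨G, hj.isInducing.continuous_iff.2 ?_, fun t x => hG (t, x)⟩
  have hj' := hj.continuous
  have hf' := FunOnFinite.continuous_linearMap ℝ ℝ f
  have hg' := FunOnFinite.continuous_linearMap ℝ ℝ g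
  refine Continuous.congr ?_ fun p => (hG p).symm
  simp only [AffineMap.lineMap_apply_module]
  fun_prop

/-- Two contiguous monotone maps that are compatible with `V` induce homotopic maps of the one-point
compactification. -/
theorem exists_homotopicRel_of_contiguous [T2Space E] (hj : IsClosedEmbedding j)
    (hr : Set.range j = realization V) {f g : P →o P} (hfg : f ≤ g)
    (hlt : ∀ x y, x < y → g x ≤ f y) (hf : ∀ x, V x ⊆ V (f x)) (hg : ∀ x, V x ⊆ V (g x))
    {S : Set (OnePoint T)}
    (hS : ∀ x : T, (x : OnePoint T) ∈ S → ∀ p ∈ support (j x).1, f p = p ∧ g p = p)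
    {F : T → T} (hF : ∀ x, j (F x) = (FunOnFinite.linearMap ℝ ℝ f (j x).1, (j x).2))
    (r : C(OnePoint T, OnePoint T)) (hrF : ⇑r = OnePoint.map F) :
    ∃ (F' : T → T) (r' : C(OnePoint T, OnePoint T)),
      (∀ x, j (F' x) = (FunOnFinite.linearMap ℝ ℝ g (j x).1, (j x).2)) ∧
      ⇑r' = OnePoint.map F' ∧ r.HomotopicRel r' S := by
  obtain ⟨G, hGc, hG⟩ := exists_pushforward_homotopy hj hr hfg hlt hf hg
  have hcont := continuous_onePointMap_homotopy hGc fun K _ hK => by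
    -- The homotopy preserves the coordinate in `E`, and the other coordinate is in a simplex.
    refine ⟨j ⁻¹' (stdSimplex ℝ P ×ˢ ((fun x => (j x).2) '' K)), ?_, ?_, ?_⟩
    · exact (((isCompact_stdSimplex ℝ P).prod
        (hK.image (continuous_snd.comp hj.continuous))).isClosed).preimage hj.continuous
    · exact hj.isCompact_preimage
        ((isCompact_stdSimplex ℝ P).prod (hK.image (continuous_snd.comp hj.continuous)))
    · intro t x hx
      exact ⟨(hr.le ⟨x, rfl⟩).1, G (t, x), hx, by simp [hG]⟩
  have h0 : (fun x => G (0, x)) = F := funext fun x => hj.injective (by simp [hG, hF])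
  refine ⟨fun x => G (1, x), ⟨_, hcont.comp (Continuous.prodMk_right (1 : I))⟩,
    fun x => by simp [hG], rfl, ⟨⟨⟨⟨_, hcont⟩, ?_, fun x => rfl⟩, ?_⟩⟩⟩
  · intro x
    simp [h0, hrF]
  · intro t x hx
    induction x using OnePoint.rec with
    | infty => simp [hrF]
    | coe x =>
      have h1 := linearMap_eq_self fun p hp => (hS x hx p hp).1
      have h2 := linearMap_eq_self fun p hp => (hS x hx p hp).2
      have e1 : G (t, x) = x := hj.injective (by rw [hG, h1, h2]; simp)
      have e2 : F x = x := hj.injective (by rw [hF, h1])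
      simp [hrF, e1, e2]

/-- The map that applies the closure operator `c` to the elements of rank at least `m` and fixes the
others. It interpolates between `c` (for `m = 0`) and the identity (for large `m`). -/
def truncatedClosure (c : ClosureOperator P) {ρ : P → ℕ} (hρ : StrictMono ρ) (m : ℕ) : P →o P where
  toFun x := if m ≤ ρ x then c x else x
  monotone' x y h := by
    have := hρ.monotone h
    dsimp only
    split_ifs with h1 h2
    · exact c.monotone h
    · omega
    · exact h.trans (c.le_closure y)
    · exact h

/-- A closure operator under which the values of `V` do not shrink deforms the one-point
compactification, relative to the part that is carried by closed elements. -/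
theorem exists_homotopicRel_closure [T2Space E] (hj : IsClosedEmbedding j)
    (hr : Set.range j = realization V)
    (c : ClosureOperator P) {ρ : P → ℕ} (hρ : StrictMono ρ) (hV : ∀ x, V x ⊆ V (c x))
    {S : Set (OnePoint T)}
    (hS : ∀ x : T, (x : OnePoint T) ∈ S → ∀ p ∈ support (j x).1, c p = p) :
    ∃ (F : T → T) (r : C(OnePoint T, OnePoint T)),
      (∀ x, j (F x) = (FunOnFinite.linearMap ℝ ℝ c (j x).1, (j x).2)) ∧
      ⇑r = OnePoint.map F ∧ (ContinuousMap.id _).HomotopicRel r S := by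
  let f := truncatedClosure c hρ
  have hf : ∀ m x, f m x = if m ≤ ρ x then c x else x := fun _ _ => rfl
  have hVf : ∀ m x, V x ⊆ V (f m x) := fun m x => by
    rw [hf]; split_ifs; exacts [hV x, subset_rfl]
  have hfix : ∀ m x, c x = x → f m x = x := fun m x h => by rw [hf, h, ite_self]
  -- Lowering the threshold `m` by one moves the elements of rank `m` only, and a chain has at most
  -- one of these, so that consecutive maps are contiguous.
  have key : ∀ k m : ℕ, (∀ x, ρ x < m + k) → ∃ (F : T → T) (r : C(OnePoint T, OnePoint T)),
      (∀ x, j (F x) = (FunOnFinite.linearMap ℝ ℝ (f m) (j x).1, (j x).2)) ∧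
      ⇑r = OnePoint.map F ∧ (ContinuousMap.id _).HomotopicRel r S := by
    intro k
    induction k with
    | zero =>
      intro m hm
      refine ⟨id, ContinuousMap.id _, fun x => ?_, by simp, .refl _⟩
      rw [linearMap_eq_self fun p _ => by rw [hf, if_neg (by have := hm p; omega)]]
      rfl
    | succ k ih =>
      intro m hm
      obtain ⟨F, r, hF, hrF, hh⟩ := ih (m + 1) fun x => by have := hm x; omega
      have hle : f (m + 1) ≤ f m := fun x => by
        rw [hf, hf]
        split_ifs
        all_goals first | rfl | exact c.le_closure x | omega
      have hlt : ∀ x y, x < y → f m x ≤ f (m + 1) y := fun x y hxy => by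
        have := hρ hxy
        rw [hf, hf]
        split_ifs
        · exact c.monotone hxy.le
        · omega
        · exact hxy.le.trans (c.le_closure y)
        · exact hxy.le
      obtain ⟨F', r', hF', hrF', hh'⟩ := exists_homotopicRel_of_contiguous hj hr hle hlt
        (hVf _) (hVf _)
        (fun x hx p hp => ⟨hfix _ p (hS x hx p hp), hfix _ p (hS x hx p hp)⟩) hF r hrF
      exact ⟨F', r', hF', hrF', hh.trans hh'⟩
  obtain ⟨N, hN⟩ := (Set.finite_range ρ).bddAbove
  obtain ⟨F, r, hF, hrF, hh⟩ := key (N + 1) 0 fun x => by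
    have := hN ⟨x, rfl⟩
    omega
  have hf0 : (f 0 : P → P) = c := funext fun x => by simp [hf]
  exact ⟨F, r, fun x => by rw [hF, hf0], hrF, hh⟩

/-- The comparison of two realizations along the insertion of closed elements `u`, with lower
adjoint `l`, is a closed embedding onto a deformation retract after one-point compactification. -/
theorem isEmbedding_and_isDeformationRetract {L T' : Type*} [PartialOrder L] [Fintype L]
    [TopologicalSpace T'] [T2Space E] [LocallyCompactSpace E] {W : L → Set E} {i : T' → (L → ℝ) × E}
    (hi : IsClosedEmbedding i) (hir : Set.range i = realization W)
    (hj : IsClosedEmbedding j) (hjr : Set.range j = realization V)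
    {l : P → L} {u : L → P} (gi : GaloisInsertion l u) {ρ : P → ℕ} (hρ : StrictMono ρ)
    (hVW : ∀ s, V s ⊆ W (l s)) (hWV : ∀ x, W x ⊆ V (u x))
    {φ : T' → T} (hφ : ∀ x, j (φ x) = (FunOnFinite.linearMap ℝ ℝ u (i x).1, (i x).2)) :
    IsEmbedding (OnePoint.map φ) ∧ IsDeformationRetract (Set.range (OnePoint.map φ)) := by
  have := hj.isEmbedding.t2Space
  have := hj.locallyCompactSpace
  refine ⟨isEmbedding_onePointMap (.of_comp hj.isEmbedding ?_), ?_⟩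
  · have h1 : IsClosedEmbedding (FunOnFinite.linearMap ℝ ℝ u) :=
      LinearMap.isClosedEmbedding_of_injective
        (LinearMap.ker_eq_bot.2 (injective_linearMap gi.u_injective))
    rw [show j ∘ φ = Prod.map (FunOnFinite.linearMap ℝ ℝ u) id ∘ i from funext hφ]
    exact (h1.prodMap .id).comp hi
  · obtain ⟨F, r, hF, hrF, hh⟩ := exists_homotopicRel_closure hj hjr gi.gc.closureOperator hρ
      (fun s => (hVW s).trans (hWV (l s))) (S := Set.range (OnePoint.map φ)) fun x hx p hp => by
        obtain ⟨y, hy⟩ := hx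
        induction y using OnePoint.rec with
        | infty => exact absurd hy (OnePoint.infty_ne_coe x)
        | coe y =>
          obtain rfl : φ y = x := OnePoint.coe_injective hy
          rw [hφ] at hp
          obtain ⟨q, -, rfl⟩ := support_linearMap_subset _ _ hp
          exact congrArg u (gi.l_u_eq q)
    refine ⟨r, fun x => ?_, hh⟩
    rw [hrF]
    induction x using OnePoint.rec with
    | infty => exact ⟨OnePoint.infty, rfl⟩
    | coe x =>
      obtain ⟨y, hy⟩ := hir.ge (linearMap_mem_realization (f := ⟨l, gi.gc.monotone_l⟩) hVW
        (hjr.le ⟨x, rfl⟩))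
      refine ⟨(y : OnePoint T'), ?_⟩
      rw [OnePoint.map_some, OnePoint.map_some]
      refine congrArg _ (hj.injective ?_)
      rw [hφ, hF, hy]
      refine Prod.ext ?_ rfl
      exact (LinearMap.congr_fun (FunOnFinite.linearMap_comp ℝ ℝ l u) (j x).1).symm

end Deformation

/-! ### Chains -/

section Chains

variable {P : Type*} [PartialOrder P]

instance [Finite P] : Finite (NonemptyFiniteChains P) :=
  Finite.of_injective NonemptyFiniteChains.finset fun _ _ => NonemptyFiniteChains.ext

/-- The one-element chain. -/
def singletonChain (x : P) : NonemptyFiniteChains P where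
  finset := {x}
  comparable := by
    rintro ⟨a, ha⟩ ⟨b, hb⟩
    rw [Finset.mem_singleton] at ha hb
    subst ha hb
    exact .inl le_rfl

theorem chainMax_singletonChain (x : P) : chainMax (singletonChain x) = x :=
  Finset.mem_singleton.1 (chainMax_spec (singletonChain x)).1

theorem chainMin_singletonChain (x : P) : chainMin (singletonChain x) = x :=
  Finset.mem_singleton.1 (chainMin_spec (singletonChain x)).1

theorem chainMin_le_chainMax (c : NonemptyFiniteChains P) : chainMin c ≤ chainMax c :=
  (chainMax_spec c).2 (chainMin_spec c).1

/-- An element below a chain can be added to it without changing the largest element. -/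
theorem exists_chain_insert (c : NonemptyFiniteChains P) {m : P} (hm : m ≤ chainMin c) :
    ∃ e : NonemptyFiniteChains P, c ≤ e ∧ singletonChain m ≤ e ∧ m ≤ chainMin e ∧
      chainMax e ≤ chainMax c := by
  classical
  have hle : ∀ a ∈ c.finset, m ≤ a := fun a ha => hm.trans ((chainMin_spec c).2 ha)
  let e : NonemptyFiniteChains P :=
    { finset := insert m c.finset
      comparable := by
        rintro ⟨a, ha⟩ ⟨b, hb⟩
        rcases Finset.mem_insert.1 ha with rfl | ha'
        · rcases Finset.mem_insert.1 hb with rfl | hb'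
          · exact .inl le_rfl
          · exact .inl (hle b hb')
        · rcases Finset.mem_insert.1 hb with rfl | hb'
          · exact .inr (hle a ha')
          · exact c.comparable ⟨a, ha'⟩ ⟨b, hb'⟩ }
  refine ⟨e, Finset.subset_insert _ _, ?_, ?_, ?_⟩
  · exact Finset.singleton_subset_iff.2 (Finset.mem_insert_self _ _)
  · rcases Finset.mem_insert.1 (chainMin_spec e).1 with h | h
    · exact h.ge
    · exact hle _ h
  · rcases Finset.mem_insert.1 (chainMax_spec e).1 with h | h
    · exact h.le.trans (hm.trans (chainMin_le_chainMax c))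
    · exact (chainMax_spec c).2 h

end Chains

/-! ### Homotopy colimits as realizations -/

section HocolimRealization

open CategoryTheory Opposite

variable {P : Type} [PartialOrder P] {D : Pᵒᵖ ⥤ TopCat.{0}} {E : TopCat.{0}}

theorem map_comp_eq_app (ι : D ⟶ (Functor.const _).obj E) {x y : P} (h : x ≤ y) (d : D.obj (op y)) :
    ι.app (op x) (D.map (homOfLE h).op d) = ι.app (op y) d :=
  ConcreteCategory.congr_hom (ι.naturality (homOfLE h).op) d

variable [Fintype P]

/-- The map to `ℝ^P × E` from the homotopy colimit of a diagram of spaces over `E`, the latter given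
by a natural transformation to the constant diagram. Its first coordinate consists of the
barycentric coordinates in `Δ(P)`. -/
noncomputable def hocolimToProd (ι : D ⟶ (Functor.const _).obj E) :
    hocolim D ⟶ TopCat.of ((P → ℝ) × E) :=
  Limits.colimit.desc (chainDiagram D)
    { pt := TopCat.of ((P → ℝ) × E)
      ι :=
        { app c := TopCat.ofHom ⟨fun z => (z.1.1, ι.app (op (chainMax c.unop)) z.2), by fun_prop⟩
          naturality c c' f := by
            refine TopCat.hom_ext (ContinuousMap.ext ?_)
            rintro ⟨w, d⟩
            refine Prod.ext rfl ?_
            exact ConcreteCategory.congr_hom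
              (ι.naturality (homOfLE (chainMax_mono (leOfHom f.unop))).op) d } }

variable (ι : D ⟶ (Functor.const _).obj E)

theorem hocolimToProd_ι (c : NonemptyFiniteChains P) (z : (chainDiagram D).obj (op c)) :
    hocolimToProd ι (Limits.colimit.ι (chainDiagram D) (op c) z) =
      (z.1.1, ι.app (op (chainMax c)) z.2) :=
  ConcreteCategory.congr_hom (Limits.colimit.ι_desc _ (op c)) z


theorem exists_isGreatest_support {w : P → ℝ} (hw : w ∈ stdSimplex ℝ P)
    (hc : IsChain (· ≤ ·) (support w)) : ∃ m, IsGreatest (support w) m := by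
  have hne : (support w).Nonempty := by
    rw [support_nonempty_iff]
    rintro rfl
    simpa using hw.2
  obtain ⟨m, hm, hmax⟩ := (support w).toFinite.exists_maximal hne
  refine ⟨m, hm, fun y hy => ?_⟩
  rcases hc.total hm hy with h | h
  · exact hmax hy h
  · exact h

/-- A point of the homotopy colimit is represented over the one-element chain at the largest vertex
of the simplex that carries its first coordinate. -/
theorem exists_rep_singletonChain {ι : D ⟶ (Functor.const _).obj E}
    (hι : ∀ x, IsClosedEmbedding (ι.app x)) (x : hocolim D) {m : P}
    (hm : IsGreatest (support (hocolimToProd ι x).1) m) :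
    ∃ z : (chainDiagram D).obj (op (singletonChain m)),
      Limits.colimit.ι (chainDiagram D) (op (singletonChain m)) z = x := by
  obtain ⟨⟨c⟩, ⟨w, d⟩, rfl⟩ := Limits.Concrete.colimit_exists_rep (chainDiagram D) x
  rw [hocolimToProd_ι ι c ⟨w, d⟩] at hm
  obtain ⟨e, hce, hme, hmin, hmax⟩ := exists_chain_insert c (w.2.2.1 hm.1)
  let d' : D.obj (op (chainMax e)) := D.map (homOfLE hmax).op d
  let w' : orderComplex (Set.Iic (chainMin e)) :=
    ⟨w.1, w.2.1, fun p hp => (hm.2 hp).trans hmin, w.2.2.2⟩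
  let z : (chainDiagram D).obj (op e) := (w', d')
  refine ⟨(chainDiagram D).map (homOfLE hme).op z, ?_⟩
  have hz : (chainDiagram D).map (homOfLE hce).op z = (w, d) := by
    refine Prod.ext rfl ((hι _).injective ?_)
    exact (map_comp_eq_app ι (chainMax_mono hce) d').trans (map_comp_eq_app ι hmax d)
  -- Both points are images of `z`, a point over the chain with `m` added.
  rw [← hz]
  exact (ConcreteCategory.congr_hom
    (Limits.colimit.w (chainDiagram D) (homOfLE hme).op) z).trans
    (ConcreteCategory.congr_hom (Limits.colimit.w (chainDiagram D) (homOfLE hce).op) z).symm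

variable {ι}

theorem hocolimToProd_mem_realization (x : hocolim D) :
    hocolimToProd ι x ∈ realization fun p => Set.range (ι.app (op p)) := by
  obtain ⟨⟨c⟩, ⟨w, d⟩, rfl⟩ := Limits.Concrete.colimit_exists_rep (chainDiagram D) x
  rw [hocolimToProd_ι ι c ⟨w, d⟩]
  refine ⟨w.2.1, w.2.2.2, fun p hp => ?_⟩
  exact ⟨_, map_comp_eq_app ι ((w.2.2.1 hp).trans (chainMin_le_chainMax c)) d⟩

theorem range_hocolimToProd :
    Set.range (hocolimToProd ι) = realization fun p => Set.range (ι.app (op p)) := by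
  refine Set.Subset.antisymm (Set.range_subset_iff.2 hocolimToProd_mem_realization) ?_
  rintro ⟨w, e⟩ ⟨hw, hc, he⟩
  obtain ⟨m, hm⟩ := exists_isGreatest_support hw hc
  obtain ⟨d, hd⟩ := he m hm.1
  let z : (chainDiagram D).obj (op (singletonChain m)) :=
    (⟨w, hw, fun p hp => (hm.2 hp).trans (chainMin_singletonChain m).ge, hc⟩,
      D.map (homOfLE (chainMax_singletonChain m).le).op d)
  refine ⟨Limits.colimit.ι (chainDiagram D) (op (singletonChain m)) z, ?_⟩
  rw [hocolimToProd_ι]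
  exact Prod.ext rfl
    ((map_comp_eq_app ι (chainMax_singletonChain m).le d).trans hd)

theorem injective_hocolimToProd (hι : ∀ x, IsClosedEmbedding (ι.app x)) :
    Function.Injective (hocolimToProd ι) := by
  intro x y h
  obtain ⟨hw, hc, -⟩ := hocolimToProd_mem_realization (ι := ι) x
  obtain ⟨m, hm⟩ := exists_isGreatest_support hw hc
  obtain ⟨z, rfl⟩ := exists_rep_singletonChain hι x hm
  rw [h] at hm
  obtain ⟨z', rfl⟩ := exists_rep_singletonChain hι y hm
  rw [hocolimToProd_ι, hocolimToProd_ι] at h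
  exact congrArg _ (Prod.ext (Subtype.ext (congrArg Prod.fst h))
    ((hι _).injective (congrArg Prod.snd h)))

theorem isClosed_orderComplex (Q : Set P) : IsClosed (orderComplex Q) := by
  have h : orderComplex Q = stdSimplex ℝ P ∩ ((⋂ p ∈ Qᶜ, {w : P → ℝ | w p = 0}) ∩
      ⋂ p, ⋂ q, {w : P → ℝ | ¬ (p ≤ q ∨ q ≤ p) → w p * w q = 0}) := by
    ext w
    simp only [orderComplex, Set.mem_ofPred_eq, Set.mem_inter_iff, Set.mem_iInter, mul_eq_zero]
    refine and_congr_right fun _ => and_congr ?_ ?_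
    · exact ⟨fun h p hp => by_contra fun hn => hp (h hn),
        fun h p hp => by_contra fun hn => hp (h p hn)⟩
    · refine ⟨fun h p q hpq => ?_, fun h p hp q hq _ => ?_⟩
      · by_contra hn
        rw [not_or] at hn
        exact hpq (h.total hn.1 hn.2)
      · by_contra hn
        exact (h p q hn).elim hp hq
  rw [h]
  refine (isClosed_stdSimplex ℝ P).inter (.inter ?_ ?_)
  · exact isClosed_biInter fun p _ => isClosed_eq (continuous_apply p) continuous_const
  · refine isClosed_iInter fun p => isClosed_iInter fun q => ?_
    by_cases hpq : p ≤ q ∨ q ≤ p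
    · simp [hpq]
    · simp only [hpq, not_false_eq_true, forall_const]
      exact isClosed_eq ((continuous_apply p).mul (continuous_apply q)) continuous_const

/-- The homotopy colimit of a diagram of closed subspaces of `E` over a finite poset is a closed
subspace of `ℝ^P × E`: the realization is a finite union of the closed images of the spaces of the
diagram `Δ(D)`. -/
theorem isClosedEmbedding_hocolimToProd (hι : ∀ x, IsClosedEmbedding (ι.app x)) :
    IsClosedEmbedding (hocolimToProd ι) := by
  refine .of_continuous_injective_isClosedMap (hocolimToProd ι).hom.continuous
    (injective_hocolimToProd hι) fun C hC => ?_
  replace hC :=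
    (TopCat.isClosed_iff_of_isColimit _ (Limits.colimit.isColimit (chainDiagram D)) C).1 hC
  have h : hocolimToProd ι '' C = ⋃ c : NonemptyFiniteChains P,
      Prod.map Subtype.val (ι.app (op (chainMax c))) ''
        (Limits.colimit.ι (chainDiagram D) (op c) ⁻¹' C) := by
    ext y
    simp only [Set.mem_image, Set.mem_iUnion]
    constructor
    · rintro ⟨x, hx, rfl⟩
      obtain ⟨⟨c⟩, z, rfl⟩ := Limits.Concrete.colimit_exists_rep (chainDiagram D) x
      exact ⟨c, z, hx, (hocolimToProd_ι ι c z).symm⟩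
    · rintro ⟨c, z, hz, rfl⟩
      exact ⟨_, hz, hocolimToProd_ι ι c z⟩
  rw [h]
  refine isClosed_iUnion_of_finite fun c => ?_
  exact ((isClosed_orderComplex _).isClosedEmbedding_subtypeVal.prodMap
    (hι (op (chainMax c)))).isClosedMap _ (hC (op c))

/-- In the coordinates of `ℝ^P × E`, the map of homotopy colimits that is induced by `f` is the
push-forward along `f`. -/
theorem hocolimToProd_hocolimMap {Q : Type} [PartialOrder Q] [Fintype Q] {D' : Qᵒᵖ ⥤ TopCat.{0}}
    {ι' : D' ⟶ (Functor.const _).obj E} (f : P →o Q) (α : D ⟶ f.monotone.functor.op ⋙ D')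
    (hα : ∀ x d, ι'.app (op (f x)) (α.app (op x) d) = ι.app (op x) d) (x : hocolim D) :
    hocolimToProd ι' (hocolimMap f α x) =
      (FunOnFinite.linearMap ℝ ℝ f (hocolimToProd ι x).1, (hocolimToProd ι x).2) := by
  obtain ⟨⟨c⟩, z, rfl⟩ := Limits.Concrete.colimit_exists_rep (chainDiagram D) x
  have h : hocolimMap f α (Limits.colimit.ι (chainDiagram D) (op c) z) =
      Limits.colimit.ι (chainDiagram D') (op (c.map f)) ((chainDiagramMap f α).app (op c) z) := by
    have h' : Limits.colimit.ι (chainDiagram D) (op c) ≫ hocolimMap f α =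
        (chainDiagramMap f α).app (op c) ≫
          Limits.colimit.ι (chainDiagram D') (op (c.map f)) :=
      (Limits.ι_colimMap_assoc _ _ _).trans (congrArg _ (Limits.colimit.ι_pre _ _ _))
    exact ConcreteCategory.congr_hom h' z
  refine (congrArg (hocolimToProd ι') h).trans ((hocolimToProd_ι ι' (c.map f) _).trans ?_)
  rw [hocolimToProd_ι]
  exact Prod.ext rfl ((map_comp_eq_app ι' (chainMax_map_le f c) _).trans (hα _ _))

end HocolimRealization

/-! ### Arrangements -/

section Arrangement

open CategoryTheory

variable {n : ℕ} (A : SubspaceArrangement n)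

/-- The inclusions of the spaces of the Ziegler–Živaljević diagram in `ℝⁿ`. -/
def zzInclusion : zzDiagram A ⟶ (Functor.const _).obj (TopCat.of (EuclideanSpace ℝ (Fin n))) where
  app _ := TopCat.ofHom ⟨Subtype.val, continuous_subtype_val⟩

/-- The inclusions of the spaces of the Vassiliev diagram in `ℝⁿ`. -/
def vassilievInclusion :
    vassilievDiagram A ⟶ (Functor.const _).obj (TopCat.of (EuclideanSpace ℝ (Fin n))) where
  app _ := TopCat.ofHom ⟨Subtype.val, continuous_subtype_val⟩

theorem isClosedEmbedding_zzInclusion (x) : IsClosedEmbedding ((zzInclusion A).app x) :=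
  (AffineSubspace.closed_of_finiteDimensional x.unop.subspace).isClosedEmbedding_subtypeVal

theorem isClosedEmbedding_vassilievInclusion (s) :
    IsClosedEmbedding ((vassilievInclusion A).app s) := by
  have h : IsClosed (faceIntersection s.unop) :=
    isClosed_biInter fun a _ => AffineSubspace.closed_of_finiteDimensional a.subspace
  exact h.isClosedEmbedding_subtypeVal

variable {A}

/-- By the antichain condition, the members of the arrangement are minimal elements of the
intersection semilattice. -/
theorem exists_isMin_subspace_eq {C : AffineSubspace ℝ (EuclideanSpace ℝ (Fin n))}
    (hC : C ∈ A.subspaces) : ∃ a : IntersectionSemilattice A, a.subspace = C ∧ IsMin a := by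
  refine ⟨⟨OrderDual.toDual C, ⟨{C}, by simp, by simpa using hC, by simp⟩, A.nonempty C hC⟩, rfl,
    fun z hz => ?_⟩
  obtain ⟨⟨S, ⟨B, hB⟩, hSA, hzS⟩, -⟩ := z.2
  have hzB : z.subspace ≤ B := hzS.le.trans (sInf_le hB)
  have hCz : C ≤ z.subspace := hz
  obtain rfl := A.eq_of_le C hC B (hSA hB) (hCz.trans hzB)
  exact hzB

/-- Every element of the intersection semilattice is the join of the minimal elements below it. -/
theorem isLUB_completeFace (x : IntersectionSemilattice A) :
    IsLUB ((completeFace (isSemilattice_intersectionSemilattice A) x).1 : Set _) x := by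
  classical
  refine ⟨fun a ha => (Finset.mem_filter.1 (Finset.mem_coe.1 ha)).2.2, fun y hy => ?_⟩
  obtain ⟨⟨S, -, hSA, hxS⟩, -⟩ := x.2
  change y.subspace ≤ OrderDual.ofDual x.1
  rw [hxS]
  refine le_sInf fun C hC => ?_
  obtain ⟨a, rfl, ha⟩ := exists_isMin_subspace_eq (hSA hC)
  have hax : a ≤ x := (IntersectionSemilattice.le_iff _ _).2 (hxS.le.trans (sInf_le hC))
  exact hy (Finset.mem_coe.2 (Finset.mem_filter.2 ⟨Finset.mem_univ _, ha, hax⟩))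

/-- The join of the vertices of a face of the nerve complex. -/
noncomputable def faceJoin (s : NerveFaces A) : IntersectionSemilattice A :=
  s.2.2.2.choose

theorem isLUB_faceJoin (s : NerveFaces A) : IsLUB (s.1 : Set _) (faceJoin s) :=
  s.2.2.2.choose_spec

/-- Passing to the join is left adjoint to passing to the complete face. -/
noncomputable def faceJoinGaloisInsertion :
    GaloisInsertion (faceJoin (A := A))
      (completeFace (isSemilattice_intersectionSemilattice A)) :=
  GaloisConnection.toGaloisInsertion
    (fun s x => by
      classical
      rw [isLUB_le_iff (isLUB_faceJoin s)]
      refine ⟨fun h a ha => Finset.mem_filter.2 ⟨Finset.mem_univ _, s.2.2.1 a ha, h ha⟩,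
        fun h a ha => ?_⟩
      exact (Finset.mem_filter.1 (h ha)).2.2)
    fun x => ((isLUB_faceJoin _).unique (isLUB_completeFace x)).ge

theorem faceIntersection_subset_subspace_faceJoin (s : NerveFaces A) :
    faceIntersection s ⊆ ((faceJoin s).subspace : Set (EuclideanSpace ℝ (Fin n))) := by
  classical
  intro p hp
  have hp' : ∀ a ∈ s.1, p ∈ a.subspace := fun a ha => Set.mem_iInter₂.1 hp a ha
  -- The intersection of all members through `p` is an upper bound of the vertices of `s`.
  let S := A.subspaces.filter fun C => p ∈ C
  have hS : ∀ a ∈ s.1, ∃ U : Finset (AffineSubspace ℝ (EuclideanSpace ℝ (Fin n))),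
      U.Nonempty ∧ U ⊆ S ∧ a.subspace = sInf (U : Set _) := by
    intro a ha
    obtain ⟨⟨U, hU, hUA, haU⟩, -⟩ := a.2
    refine ⟨U, hU, fun C hC => Finset.mem_filter.2 ⟨hUA hC, ?_⟩, haU⟩
    have hle : a.subspace ≤ C := haU.le.trans (sInf_le hC)
    exact hle (hp' a ha)
  have hpS : p ∈ sInf (S : Set (AffineSubspace ℝ (EuclideanSpace ℝ (Fin n)))) := by
    rw [AffineSubspace.mem_sInf_iff]
    exact fun C hC => (Finset.mem_filter.1 hC).2
  obtain ⟨a, ha⟩ := s.2.1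
  obtain ⟨U, hU, hUS, -⟩ := hS a ha
  let z : IntersectionSemilattice A := ⟨OrderDual.toDual (sInf (S : Set _)),
    ⟨S, hU.mono hUS, Finset.filter_subset _ _, rfl⟩, ⟨p, hpS⟩⟩
  have hz : faceJoin s ≤ z := (isLUB_faceJoin s).2 fun b hb => by
    obtain ⟨U, -, hUS, hbU⟩ := hS b hb
    refine (IntersectionSemilattice.le_iff _ _).2 ?_
    rw [hbU]
    exact sInf_le_sInf (Finset.coe_subset.2 hUS)
  exact (IntersectionSemilattice.le_iff _ _).1 hz hpS

end Arrangement

end SubspaceModels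

open SubspaceModels in
theorem theorem4p3 (n : ℕ) (A : SubspaceModels.SubspaceArrangement n) :
    Topology.IsEmbedding (OnePoint.map (SubspaceModels.comparisonMap A)) ∧
      SubspaceModels.IsDeformationRetract
        (Set.range (OnePoint.map (SubspaceModels.comparisonMap A))) := by
  refine isEmbedding_and_isDeformationRetract
    (isClosedEmbedding_hocolimToProd (isClosedEmbedding_zzInclusion A)) range_hocolimToProd
    (isClosedEmbedding_hocolimToProd (isClosedEmbedding_vassilievInclusion A)) range_hocolimToProd
    faceJoinGaloisInsertion (ρ := fun s : NerveFaces A => s.1.card)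
    (fun s t h => Finset.card_lt_card h) (fun s => ?_) (fun x => ?_)
    (hocolimToProd_hocolimMap _ _ fun _ _ => rfl)
  · rintro _ ⟨p, rfl⟩
    exact ⟨⟨p.1, faceIntersection_subset_subspace_faceJoin s p.2⟩, rfl⟩
  · rintro _ ⟨p, rfl⟩
    exact ⟨⟨p.1, subspace_subset_faceIntersection x p.2⟩, rfl⟩
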